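/- Let $\mathbf{Hilb}$ be the category of finite-dimensional complex Hilbert spaces and linear maps, with its tensor product, adjoints $f^\dagger$, dual spaces $A^*$ (themselves Hilbert spaces), evaluations $\eta_A : A\otimes A^*\to\mathbb{C}$, and $\epsilon_A := \eta_{A^*}^\dagger : \mathbb{C}\to A^*\otimes A$, where $A^{**}=A$. For $f:A\to B$ let $f^*:B^*\to A^*$ be the dual map and $f_* := (f^\dagger)^* : A^*\to B^*$ the conjugate. An involution monoid $(A,m,u;s)$ in $\mathbf{Hilb}$ consists of a unital associative multiplication $m:A\otimes A\to A$ with unit $u:\mathbb{C}\to A$ and a linear map $s:A\to A^*$ which is a morphism of monoids $(A,m,u)\to(A^*,m_*,u_*)$, under the order-reversing identification $(A\otimes A)^* = A^*\otimes A^*$, and satisfies $s_*\circ s=\mathrm{id}_A$. A homomorphism of involution monoids is a linear map $f:A\to B$ which preserves multiplication and unit and satisfies $s_B\circ f=f_*\circ s_A$. The underlying $*$-algebra of $(A,m,u;s)$ has product $m$, unit $u(1)$ and antilinear involution $a\mapsto a^*$ given by $\langle a^*,\cdot\rangle=s(a)$; conversely, a finite-dimensional $*$-algebra with an inner product is an involution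 monoid. The monoid is * $\dagger$-Frobenius if $(m\otimes\mathrm{id})(\mathrm{id}\otimes m^\dagger)=m^\dagger m=(\mathrm{id}\otimes m)(m^\dagger\otimes\mathrm{id})$; its left and right involutions $A\to A^*$ are then $s_L=((u^\dagger m)\otimes\mathrm{id}_{A^*})(\mathrm{id}_A\otimes\epsilon_{A^*})$ and $s_R=(\mathrm{id}_{A^*}\otimes(u^\dagger m))(\epsilon_A\otimes\mathrm{id}_A)$; * a $\dagger$-Frobenius right-involution monoid if it is $\dagger$-Frobenius and $s=s_R$; * a unitary $\dagger$-Frobenius involution monoid if moreover $s_L$ (equivalently $s_R$) is unitary, in which case $s_L=s_R$; * special if $m\circ m^\dagger=\mathrm{id}_A$. All categories below have the involution-preserving unital homomorphisms as morphisms. A finite-dimensional C*-algebra is a finite-dimensional unital complex $*$-algebra which admits a norm making it a C*-algebra. Theorem. The category of finite-dimensional C*-algebras is 1. equal to the category of special unitary $\dagger$-Frobenius involution monoids in $\mathbf{Hilb}$, where the objects of the latter are taken to be the finite-dimensional $*$-algebras which admit an inner product making them such a monoid. If objects are instead equipped with their norm, respectively inner product, then the C*-norm is unique and the passage from an involution monoid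 to its underlying $*$-algebra is an isomorphism of categories (fully faithful and bijective on objects); 2. equivalent to the category of unitary $\dagger$-Frobenius involution monoids in $\mathbf{Hilb}$; and 3. equivalent to the category of $\dagger$-Frobenius right-involution monoids in $\mathbf{Hilb}$. In 2 and 3 the equivalence is given by passing to the underlying $*$-algebra. -/

import Mathlib

open CategoryTheory
open scoped TensorProduct

universe u

noncomputable section

namespace DagFrob

/-! ### Duals, adjoints and conjugates of finite-dimensional Hilbert spaces -/

section Hilb

variable {A B : Type*} [NormedAddCommGroup A] [InnerProductSpace ℂ A] [FiniteDimensional ℂ A]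
  [NormedAddCommGroup B] [InnerProductSpace ℂ B] [FiniteDimensional ℂ B]

/-- The antilinear Riesz isomorphism `a ↦ ⟪a, ·⟫` from a finite-dimensional Hilbert space to its
dual `A^*`. -/
def riesz (A : Type*) [NormedAddCommGroup A] [InnerProductSpace ℂ A] [FiniteDimensional ℂ A] :
    A ≃ₗᵢ⋆[ℂ] StrongDual ℂ A :=
  haveI := FiniteDimensional.complete ℂ A
  InnerProductSpace.toDual ℂ A

theorem riesz_apply (a b : A) : riesz A a b = inner ℂ a b := rfl

theorem inner_riesz_symm (φ : StrongDual ℂ A) (b : A) : inner ℂ ((riesz A).symm φ) b = φ b := by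
  rw [← riesz_apply, LinearIsometryEquiv.apply_symm_apply]

/-- The dual `A^*` is a Hilbert space, with `⟪⟪a, ·⟫, ⟪b, ·⟫⟫ = ⟪b, a⟫`. -/
instance dualInnerProductSpace : InnerProductSpace ℂ (StrongDual ℂ A) where
  inner φ ψ := inner ℂ ((riesz A).symm ψ) ((riesz A).symm φ)
  norm_sq_eq_re_inner φ := by
    rw [← LinearIsometryEquiv.norm_map (riesz A).symm φ]
    exact norm_sq_eq_re_inner (𝕜 := ℂ) _
  conj_inner_symm φ ψ := inner_conj_symm _ _
  add_left φ ψ χ := by rw [map_add, inner_add_right]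
  smul_left φ ψ r := by
    rw [LinearIsometryEquiv.map_smulₛₗ, inner_smul_right]

instance dualFiniteDimensional : FiniteDimensional ℂ (StrongDual ℂ A) :=
  Module.Finite.equiv (LinearMap.toContinuousLinearMap (𝕜 := ℂ) (E := A) (F' := ℂ))

/-- The dual map `f^* : B^* → A^*`, `φ ↦ φ ∘ f`. -/
def dualMap (f : A →ₗ[ℂ] B) : StrongDual ℂ B →ₗ[ℂ] StrongDual ℂ A where
  toFun φ := φ.comp (LinearMap.toContinuousLinearMap f)
  map_add' _ _ := rfl
  map_smul' _ _ := rfl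

/-- The conjugate `f_* = (f^†)^* : A^* → B^*`. -/
def conjMap (f : A →ₗ[ℂ] B) : StrongDual ℂ A →ₗ[ℂ] StrongDual ℂ B :=
  dualMap (LinearMap.adjoint f)

/-- The canonical isomorphism `A → A^{**}` along which `A^{**}` is identified with `A`. -/
def doubleDual (A : Type*) [NormedAddCommGroup A] [InnerProductSpace ℂ A]
    [FiniteDimensional ℂ A] : A →ₗ[ℂ] StrongDual ℂ (StrongDual ℂ A) :=
  (NormedSpace.inclusionInDoubleDual ℂ A).toLinearMap

/-- The canonical order-reversing isomorphism `A^* ⊗ B^* → (B ⊗ A)^*`,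
`(φ ⊗ ψ) (b ⊗ a) = φ a * ψ b`. -/
def dualTensor (A B : Type*) [NormedAddCommGroup A] [InnerProductSpace ℂ A]
    [FiniteDimensional ℂ A] [NormedAddCommGroup B] [InnerProductSpace ℂ B]
    [FiniteDimensional ℂ B] :
    StrongDual ℂ A ⊗[ℂ] StrongDual ℂ B →ₗ[ℂ] StrongDual ℂ (B ⊗[ℂ] A) :=
  TensorProduct.lift (LinearMap.mk₂ ℂ
    (fun φ ψ => LinearMap.toContinuousLinearMap
      (LinearMap.mul' ℂ ℂ ∘ₗ TensorProduct.map ψ.toLinearMap φ.toLinearMap))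
    (fun φ φ' ψ => by ext x; simp [TensorProduct.map_add_right])
    (fun c φ ψ => by ext x; simp [TensorProduct.map_smul_right])
    (fun φ ψ ψ' => by ext x; simp [TensorProduct.map_add_left])
    (fun c φ ψ => by ext x; simp [TensorProduct.map_smul_left]))

/-- The canonical isomorphism `ℂ → ℂ^*`, `z ↦ (w ↦ z * w)`. -/
def dualUnit : ℂ →ₗ[ℂ] StrongDual ℂ ℂ :=
  (ContinuousLinearMap.mul ℂ ℂ).toLinearMap

/-- The duality morphism `η_A : A ⊗ A^* → ℂ`, `a ⊗ φ ↦ φ a`. -/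
def cap (A : Type*) [NormedAddCommGroup A] [InnerProductSpace ℂ A] [FiniteDimensional ℂ A] :
    A ⊗[ℂ] StrongDual ℂ A →ₗ[ℂ] ℂ :=
  TensorProduct.lift (LinearMap.mk₂ ℂ (fun a (φ : StrongDual ℂ A) => φ a)
    (fun _ _ φ => map_add φ _ _) (fun _ _ φ => map_smul φ _ _) (fun _ _ _ => rfl)
    (fun _ _ _ => rfl))

/-- The duality morphism `η_{A^*} : A^* ⊗ A → ℂ`, `φ ⊗ a ↦ φ a`, with `A^{**}` identified
with `A`. -/
def capDual (A : Type*) [NormedAddCommGroup A] [InnerProductSpace ℂ A] [FiniteDimensional ℂ A] :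
    StrongDual ℂ A ⊗[ℂ] A →ₗ[ℂ] ℂ :=
  TensorProduct.lift (LinearMap.mk₂ ℂ (fun (φ : StrongDual ℂ A) a => φ a)
    (fun _ _ _ => rfl) (fun _ _ _ => rfl) (fun φ _ _ => map_add φ _ _)
    (fun _ φ _ => map_smul φ _ _))

/-- The duality morphism `ε_A = η_{A^*}^† : ℂ → A^* ⊗ A`. -/
def cup (A : Type*) [NormedAddCommGroup A] [InnerProductSpace ℂ A] [FiniteDimensional ℂ A] :
    ℂ →ₗ[ℂ] StrongDual ℂ A ⊗[ℂ] A :=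
  LinearMap.adjoint (𝕜 := ℂ) (E := StrongDual ℂ A ⊗[ℂ] A) (F := ℂ) (capDual A)

/-- The duality morphism `ε_{A^*} = η_A^† : ℂ → A ⊗ A^*`. -/
def cupDual (A : Type*) [NormedAddCommGroup A] [InnerProductSpace ℂ A] [FiniteDimensional ℂ A] :
    ℂ →ₗ[ℂ] A ⊗[ℂ] StrongDual ℂ A :=
  LinearMap.adjoint (𝕜 := ℂ) (E := A ⊗[ℂ] StrongDual ℂ A) (F := ℂ) (cap A)

theorem conjMap_riesz (f : A →ₗ[ℂ] B) (a : A) : conjMap f (riesz A a) = riesz B (f a) := by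
  ext b
  exact LinearMap.adjoint_inner_right f a b

theorem dualTensor_riesz (a : A) (b : B) :
    dualTensor A B (riesz A a ⊗ₜ[ℂ] riesz B b) = riesz (B ⊗[ℂ] A) (b ⊗ₜ[ℂ] a) := by
  ext z
  induction z using TensorProduct.induction_on with
  | zero => rw [map_zero, map_zero]
  | add x y hx hy => rw [map_add, map_add, hx, hy]
  | tmul x y => rw [riesz_apply, TensorProduct.inner_tmul]; rfl

theorem dualUnit_one : dualUnit 1 = riesz ℂ 1 := by
  ext
  simp [dualUnit, riesz_apply]

theorem doubleDual_apply (a : A) (φ : StrongDual ℂ A) : doubleDual A a φ = φ a := rfl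

theorem riesz_dual_apply (φ ψ : StrongDual ℂ A) :
    riesz (StrongDual ℂ A) φ ψ = ψ ((riesz A).symm φ) := by
  rw [← inner_riesz_symm ψ]
  rfl

/-- `f^† ∘ f = id` and `f ∘ f^† = id`. -/
def IsUnitaryMap (f : A →ₗ[ℂ] B) : Prop :=
  LinearMap.adjoint f ∘ₗ f = LinearMap.id ∧ f ∘ₗ LinearMap.adjoint f = LinearMap.id

end Hilb

/-! ### Monoids in the category of finite-dimensional Hilbert spaces -/

/-- A finite-dimensional complex Hilbert space: a finite-dimensional complex vector space with an
inner product. -/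
structure FdHilb where
  carrier : Type u
  [addCommGroup : AddCommGroup carrier]
  [module : Module ℂ carrier]
  core : InnerProductSpace.Core ℂ carrier
  [finiteDimensional : FiniteDimensional ℂ carrier]

instance : CoeSort FdHilb.{u} (Type u) := ⟨FdHilb.carrier⟩

instance (H : FdHilb.{u}) : NormedAddCommGroup H :=
  letI := H.addCommGroup
  letI := H.module
  H.core.toNormedAddCommGroup

instance (H : FdHilb.{u}) : InnerProductSpace ℂ H :=
  letI := H.addCommGroup
  letI := H.module
  InnerProductSpace.ofCore H.core.toCore

instance (H : FdHilb.{u}) : FiniteDimensional ℂ H :=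
  H.finiteDimensional

/-- A monoid `(A, m, u)` in the monoidal category of finite-dimensional Hilbert spaces. -/
structure HilbMonoid where
  obj : FdHilb.{u}
  mul : obj ⊗[ℂ] obj →ₗ[ℂ] obj
  unit : ℂ →ₗ[ℂ] obj
  mul_assoc : mul ∘ₗ mul.rTensor obj =
    mul ∘ₗ mul.lTensor obj ∘ₗ (TensorProduct.assoc ℂ obj obj obj).toLinearMap
  unit_mul : mul ∘ₗ unit.rTensor obj = (TensorProduct.lid ℂ obj).toLinearMap
  mul_unit : mul ∘ₗ unit.lTensor obj = (TensorProduct.rid ℂ obj).toLinearMap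

namespace HilbMonoid

variable (M : HilbMonoid.{u})

/-- The comultiplication `m^†`. -/
def comul : M.obj →ₗ[ℂ] M.obj ⊗[ℂ] M.obj := LinearMap.adjoint M.mul

/-- The counit `u^†`. -/
def counit : M.obj →ₗ[ℂ] ℂ := LinearMap.adjoint M.unit

/-- The monoid is †-Frobenius:
`(m ⊗ id) ∘ (id ⊗ m^†) = m^† ∘ m = (id ⊗ m) ∘ (m^† ⊗ id)`. -/
def IsFrobenius : Prop :=
  M.mul.rTensor M.obj ∘ₗ (TensorProduct.assoc ℂ M.obj M.obj M.obj).symm.toLinearMap ∘ₗ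
      M.comul.lTensor M.obj = M.comul ∘ₗ M.mul ∧
    M.comul ∘ₗ M.mul =
      M.mul.lTensor M.obj ∘ₗ (TensorProduct.assoc ℂ M.obj M.obj M.obj).toLinearMap ∘ₗ
        M.comul.rTensor M.obj

/-- The left involution `((u^† ∘ m) ⊗ id_{A^*}) ∘ (id_A ⊗ ε_{A^*}) : A → A^*`. -/
def leftInvolution : M.obj →ₗ[ℂ] StrongDual ℂ M.obj :=
  (TensorProduct.lid ℂ (StrongDual ℂ M.obj)).toLinearMap ∘ₗ
    (M.counit ∘ₗ M.mul).rTensor (StrongDual ℂ M.obj) ∘ₗ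
    (TensorProduct.assoc ℂ M.obj M.obj (StrongDual ℂ M.obj)).symm.toLinearMap ∘ₗ
    (cupDual M.obj).lTensor M.obj ∘ₗ
    (TensorProduct.rid ℂ M.obj).symm.toLinearMap

/-- The right involution `(id_{A^*} ⊗ (u^† ∘ m)) ∘ (ε_A ⊗ id_A) : A → A^*`. -/
def rightInvolution : M.obj →ₗ[ℂ] StrongDual ℂ M.obj :=
  (TensorProduct.rid ℂ (StrongDual ℂ M.obj)).toLinearMap ∘ₗ
    (M.counit ∘ₗ M.mul).lTensor (StrongDual ℂ M.obj) ∘ₗ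
    (TensorProduct.assoc ℂ (StrongDual ℂ M.obj) M.obj M.obj).toLinearMap ∘ₗ
    (cup M.obj).rTensor M.obj ∘ₗ
    (TensorProduct.lid ℂ M.obj).symm.toLinearMap

/-- The left involution is unitary (for †-Frobenius monoids this is equivalent to unitarity of the
right involution). -/
def IsUnitary : Prop := IsUnitaryMap M.leftInvolution

/-- `m ∘ m^† = id`. -/
def IsSpecial : Prop := M.mul ∘ₗ M.comul = LinearMap.id

end HilbMonoid

/-- An involution monoid `(A, m, u; s)` in the category of finite-dimensional Hilbert spaces:
`s : A → A^*` is a morphism of monoids to `(A^*, m_*, u_*)` with `s_* ∘ s = id`. The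
identifications `A^* ⊗ A^* = (A ⊗ A)^*`, `ℂ = ℂ^*` and `A = A^{**}` are written explicitly. -/
structure InvolutionMonoid extends HilbMonoid.{u} where
  invol : obj →ₗ[ℂ] StrongDual ℂ obj
  invol_mul : invol ∘ₗ mul =
    (conjMap mul ∘ₗ dualTensor obj obj) ∘ₗ TensorProduct.map invol invol
  invol_unit : invol ∘ₗ unit = conjMap unit ∘ₗ dualUnit
  invol_invol : conjMap invol ∘ₗ invol = doubleDual obj

namespace InvolutionMonoid

/-- Homomorphisms of involution monoids: morphisms of monoids with `s_B ∘ f = f_* ∘ s_A`. -/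
@[ext]
structure Hom (M N : InvolutionMonoid.{u}) where
  map : M.obj →ₗ[ℂ] N.obj
  map_mul : map ∘ₗ M.mul = N.mul ∘ₗ TensorProduct.map map map
  map_unit : map ∘ₗ M.unit = N.unit
  map_invol : N.invol ∘ₗ map = conjMap map ∘ₗ M.invol

theorem conjMap_id (A : Type*) [NormedAddCommGroup A] [InnerProductSpace ℂ A]
    [FiniteDimensional ℂ A] : conjMap (LinearMap.id : A →ₗ[ℂ] A) = LinearMap.id := by
  ext φ a
  simp [conjMap, dualMap]

theorem conjMap_comp {A B C : Type*} [NormedAddCommGroup A] [InnerProductSpace ℂ A]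
    [FiniteDimensional ℂ A] [NormedAddCommGroup B] [InnerProductSpace ℂ B]
    [FiniteDimensional ℂ B] [NormedAddCommGroup C] [InnerProductSpace ℂ C]
    [FiniteDimensional ℂ C] (g : B →ₗ[ℂ] C) (f : A →ₗ[ℂ] B) :
    conjMap (g ∘ₗ f) = conjMap g ∘ₗ conjMap f := by
  ext φ a
  simp only [conjMap, LinearMap.adjoint_comp]
  rfl

instance : Category InvolutionMonoid.{u} where
  Hom := Hom
  id M := ⟨LinearMap.id, by simp, by simp, by simp [conjMap_id]⟩
  comp {M N P} f g := ⟨g.map ∘ₗ f.map,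
    by rw [LinearMap.comp_assoc, f.map_mul, ← LinearMap.comp_assoc, g.map_mul,
      LinearMap.comp_assoc, TensorProduct.map_comp],
    by rw [LinearMap.comp_assoc, f.map_unit, g.map_unit],
    by rw [← LinearMap.comp_assoc, g.map_invol, LinearMap.comp_assoc, f.map_invol,
      conjMap_comp, LinearMap.comp_assoc]⟩

/-- †-Frobenius right-involution monoids. -/
def rightFrobenius : ObjectProperty InvolutionMonoid.{u} :=
  fun M => M.IsFrobenius ∧ M.invol = M.rightInvolution

/-- Unitary †-Frobenius involution monoids. By unitarity the left and right involutions agree. -/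
def unitaryFrobenius : ObjectProperty InvolutionMonoid.{u} :=
  fun M => rightFrobenius M ∧ M.IsUnitary

/-- Special unitary †-Frobenius involution monoids. -/
def specialUnitaryFrobenius : ObjectProperty InvolutionMonoid.{u} :=
  fun M => unitaryFrobenius M ∧ M.IsSpecial

end InvolutionMonoid

/-! ### Finite-dimensional `*`-algebras -/

/-- A finite-dimensional complex, associative, unital `*`-algebra. -/
structure FdStarAlg where
  carrier : Type u
  [ring : Ring carrier]
  [algebra : Algebra ℂ carrier]
  [starRing : StarRing carrier]
  [starModule : StarModule ℂ carrier]
  [finiteDimensional : FiniteDimensional ℂ carrier]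

namespace FdStarAlg

instance : CoeSort FdStarAlg.{u} (Type u) := ⟨FdStarAlg.carrier⟩

attribute [instance] ring algebra starRing starModule finiteDimensional

/-- Morphisms are the unital, involution-preserving algebra homomorphisms. -/
instance : Category FdStarAlg.{u} where
  Hom X Y := X →⋆ₐ[ℂ] Y
  id X := StarAlgHom.id ℂ X
  comp f g := g.comp f

/-- `N` is a norm making the `*`-algebra a C*-algebra: an algebra norm which is complete and
satisfies the C*-identity. -/
def IsCStarNorm {X : FdStarAlg.{u}} (N : AlgebraNorm ℂ X) : Prop :=
  (∀ a : X, N (star a * a) = N a ^ 2) ∧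
    ∀ x : ℕ → X, (∀ δ > 0, ∃ K, ∀ m ≥ K, ∀ n ≥ K, N (x m - x n) < δ) →
      ∃ l : X, ∀ δ > 0, ∃ K, ∀ n ≥ K, N (x n - l) < δ

/-- The `*`-algebra admits a norm making it a C*-algebra. -/
def admitsCStarNorm : ObjectProperty FdStarAlg.{u} :=
  fun X => ∃ N : AlgebraNorm ℂ X, IsCStarNorm N

variable (X : FdStarAlg.{u}) (c : InnerProductSpace.Core ℂ X)

/-- The underlying vector space of a `*`-algebra, with a given inner product. -/
def hilb : FdHilb.{u} where
  carrier := X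
  core := c


/-- The identity map, from the `*`-algebra to the Hilbert space on it. -/
def toHilb : X ≃ₗ[ℂ] X.hilb c := LinearEquiv.refl ℂ X

/-- The involution monoid given by a `*`-algebra and an inner product on its underlying vector
space, with linear involution `s a = ⟪a^*, ·⟫`. -/
def toInvolutionMonoid : InvolutionMonoid.{u} where
  obj := X.hilb c
  mul := (X.toHilb c).toLinearMap ∘ₗ LinearMap.mul' ℂ X ∘ₗ
    TensorProduct.map (X.toHilb c).symm.toLinearMap (X.toHilb c).symm.toLinearMap
  unit := (X.toHilb c).toLinearMap ∘ₗ Algebra.linearMap ℂ X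
  mul_assoc := TensorProduct.ext_threefold fun x y z => by simp [mul_assoc]
  unit_mul := TensorProduct.ext' fun z x => by simp [← Algebra.smul_def]
  mul_unit := TensorProduct.ext' fun x z => by
    simp [← Algebra.commutes, ← Algebra.smul_def]
  invol :=
    { toFun := fun a => riesz (X.hilb c) (X.toHilb c (star ((X.toHilb c).symm a)))
      map_add' := fun a b => by simp
      map_smul' := fun z a => by
        simp [LinearIsometryEquiv.map_smulₛₗ] }
  invol_mul := TensorProduct.ext' fun x y => by
    simp [dualTensor_riesz, conjMap_riesz]
  invol_unit := LinearMap.ext_ring (by simp [dualUnit_one, conjMap_riesz])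
  invol_invol := LinearMap.ext fun a => by
    ext φ
    simp [conjMap_riesz, riesz_dual_apply, doubleDual_apply]

/-- The `*`-algebra admits an inner product making it a special unitary †-Frobenius involution
monoid. -/
def admitsSpecialUnitaryFrobenius : ObjectProperty FdStarAlg.{u} :=
  fun X => ∃ c : InnerProductSpace.Core ℂ X,
    InvolutionMonoid.specialUnitaryFrobenius (X.toInvolutionMonoid c)

end FdStarAlg

/-! ### The `*`-algebra underlying an involution monoid -/

namespace InvolutionMonoid

variable (M : InvolutionMonoid.{u})

/-- The antilinear involution `t` on `A`, where `⟪t a, ·⟫ = s a`. -/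
def antiInvol (a : M.obj) : M.obj := (riesz M.obj).symm (M.invol a)

theorem riesz_antiInvol (a : M.obj) : riesz M.obj (M.antiInvol a) = M.invol a :=
  LinearIsometryEquiv.apply_symm_apply _ _

theorem antiInvol_antiInvol (a : M.obj) : M.antiInvol (M.antiInvol a) = a := by
  have h := LinearMap.congr_fun M.invol_invol a
  rw [LinearMap.comp_apply, ← riesz_antiInvol, conjMap_riesz] at h
  refine (riesz M.obj).injective (ContinuousLinearMap.ext fun b => ?_)
  have h' := DFunLike.congr_fun h (riesz M.obj b)
  rw [riesz_dual_apply, doubleDual_apply, riesz_apply, riesz_apply] at h'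
  rw [riesz_apply, riesz_apply, ← inner_conj_symm, ← inner_conj_symm a b]
  exact congrArg _ h'

theorem antiInvol_mul (a b : M.obj) :
    M.antiInvol (M.mul (a ⊗ₜ b)) = M.mul (M.antiInvol b ⊗ₜ M.antiInvol a) := by
  have h := LinearMap.congr_fun M.invol_mul (a ⊗ₜ b)
  rw [LinearMap.comp_apply, LinearMap.comp_apply, LinearMap.comp_apply, TensorProduct.map_tmul,
    ← riesz_antiInvol, ← riesz_antiInvol, ← riesz_antiInvol, dualTensor_riesz, conjMap_riesz] at h
  exact (riesz M.obj).injective h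

theorem one_mul' (a : M.obj) : M.mul (M.unit 1 ⊗ₜ a) = a := by
  have h := LinearMap.congr_fun M.unit_mul (1 ⊗ₜ a)
  simpa using h

theorem mul_one' (a : M.obj) : M.mul (a ⊗ₜ M.unit 1) = a := by
  have h := LinearMap.congr_fun M.mul_unit (a ⊗ₜ 1)
  simpa using h

theorem mul_assoc' (a b d : M.obj) :
    M.mul (M.mul (a ⊗ₜ b) ⊗ₜ d) = M.mul (a ⊗ₜ M.mul (b ⊗ₜ d)) := by
  have h := LinearMap.congr_fun M.mul_assoc ((a ⊗ₜ b) ⊗ₜ d)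
  simpa using h

/-- The ring structure with product `m (a ⊗ b)` and unit `u 1`. -/
@[reducible]
def toRing : Ring M.obj :=
  { (inferInstance : AddCommGroup M.obj) with
    mul := fun a b => M.mul (a ⊗ₜ b)
    one := M.unit 1
    left_distrib := fun a b d => (congrArg M.mul (TensorProduct.tmul_add a b d)).trans
      (map_add _ _ _)
    right_distrib := fun a b d => (congrArg M.mul (TensorProduct.add_tmul a b d)).trans
      (map_add _ _ _)
    zero_mul := fun a => (congrArg M.mul (TensorProduct.zero_tmul _ a)).trans (map_zero _)
    mul_zero := fun a => (congrArg M.mul (TensorProduct.tmul_zero _ a)).trans (map_zero _)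
    mul_assoc := M.mul_assoc'
    one_mul := M.one_mul'
    mul_one := M.mul_one' }

/-- The algebra structure, with the scalar multiplication of the vector space. -/
@[reducible]
def toAlgebra : @Algebra ℂ M.obj _ M.toRing.toSemiring :=
  letI := M.toRing
  Algebra.ofModule
    (fun z a b => (congrArg M.mul (TensorProduct.smul_tmul' z a b).symm).trans (map_smul _ _ _))
    (fun z a b => (congrArg M.mul (TensorProduct.tmul_smul z a b)).trans (map_smul _ _ _))

/-- The involution `a^*`, determined by `⟪a^*, ·⟫ = s a`. -/
@[reducible]
def toStarRing : @StarRing M.obj M.toRing.toNonUnitalNonAssocSemiring :=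
  letI := M.toRing
  { star := M.antiInvol
    star_involutive := M.antiInvol_antiInvol
    star_mul := M.antiInvol_mul
    star_add := fun a b => by
      change M.antiInvol (a + b) = M.antiInvol a + M.antiInvol b
      rw [antiInvol, map_add]
      exact map_add (riesz M.obj).symm _ _ }

theorem antiInvol_smul (z : ℂ) (a : M.obj) : M.antiInvol (z • a) = star z • M.antiInvol a := by
  rw [antiInvol, map_smul]
  exact LinearIsometryEquiv.map_smulₛₗ _ _ _

/-- The `*`-algebra underlying an involution monoid. -/
def toStarAlg : FdStarAlg.{u} where
  carrier := M.obj
  ring := M.toRing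
  algebra := M.toAlgebra
  starRing := M.toStarRing
  starModule := @StarModule.mk _ _ _ M.toStarRing.toStar _ M.antiInvol_smul
  finiteDimensional := inferInstanceAs (FiniteDimensional ℂ M.obj)

variable {M} in
theorem Hom.map_antiInvol {N : InvolutionMonoid.{u}} (f : Hom M N) (a : M.obj) :
    f.map (M.antiInvol a) = N.antiInvol (f.map a) := by
  have h := LinearMap.congr_fun f.map_invol a
  rw [LinearMap.comp_apply, LinearMap.comp_apply, ← riesz_antiInvol, ← riesz_antiInvol,
    conjMap_riesz] at h
  exact ((riesz N.obj).injective h).symm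

/-- The functor which sends an involution monoid to its underlying `*`-algebra, and which is the
identity on the underlying linear maps. -/
def underlying : InvolutionMonoid.{u} ⥤ FdStarAlg.{u} where
  obj M := M.toStarAlg
  map {M N} f :=
    { toFun := f.map
      map_one' := LinearMap.congr_fun f.map_unit 1
      map_mul' := fun a b => LinearMap.congr_fun f.map_mul (a ⊗ₜ b)
      map_zero' := map_zero f.map
      map_add' := map_add f.map
      commutes' := fun z => (map_smul f.map z (M.unit 1)).trans
        (congrArg (z • ·) (LinearMap.congr_fun f.map_unit 1))
      map_star' := f.map_antiInvol }

end InvolutionMonoid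

/-! ### The categories -/

/-- The category of finite-dimensional C*-algebras. -/
abbrev FdCStarAlg : Type (u + 1) := FdStarAlg.admitsCStarNorm.{u}.FullSubcategory

/-- The category of special unitary †-Frobenius involution monoids, with objects the `*`-algebras
admitting an inner product of the required kind. -/
abbrev SpecialUnitaryFrobAlg : Type (u + 1) :=
  FdStarAlg.admitsSpecialUnitaryFrobenius.{u}.FullSubcategory

/-- The category of special unitary †-Frobenius involution monoids, with objects equipped with
their inner product. -/
abbrev SpecialUnitaryFrobMon : Type (u + 1) :=
  InvolutionMonoid.specialUnitaryFrobenius.{u}.FullSubcategory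

/-- The category of unitary †-Frobenius involution monoids. -/
abbrev UnitaryFrobMon : Type (u + 1) :=
  InvolutionMonoid.unitaryFrobenius.{u}.FullSubcategory

/-- The category of †-Frobenius right-involution monoids. -/
abbrev RightFrobMon : Type (u + 1) :=
  InvolutionMonoid.rightFrobenius.{u}.FullSubcategory

end DagFrob

end

open DagFrob

/-! Write `a^*` for the vector with `⟪a^*, ·⟫ = s a`. In an orthonormal basis the duality diagrams
become `s_L a b = ⟪1, ab⟫` and `s_R a b = ⟪1, ba⟫`.

From monoids to C*-algebras: `s = s_R` makes right multiplication by `a^*` the Hilbert space adjoint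
of right multiplication by `a`. The operator norm of right multiplication is then a C*-norm
(`isCStarNorm_rightMulNorm`).

Conversely, on a finite-dimensional C*-algebra the trace `τ x` of left multiplication by `x` is
tracial, positive and faithful, so `⟪a, b⟫ = τ (a^* b)` is an inner product. Traciality gives `s_L =
s = s_R`, hence the Frobenius law and unitarity. Given these, specialness means exactly `⟪1, ·⟫ = τ`
(`inner_unit_eq_trace_iff_isSpecial`), so it holds for this inner product and no other.

Thus the underlying-algebra functor is surjective on objects already from special monoids, and
injective there because the inner product is forced. It is always fully faithful, since preserving
`s` amounts to preserving `a ↦ a^*`, whatever the inner products. -/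

/-! ### The regular trace of a finite-dimensional C*-algebra. -/

section RegularTrace

open scoped ComplexOrder

/-- The trace of the left regular representation. -/
noncomputable def regularTrace (A : Type*) [Ring A] [Algebra ℂ A] : A →ₗ[ℂ] ℂ :=
  LinearMap.trace ℂ A ∘ₗ (Algebra.lmul ℂ A).toLinearMap

theorem regularTrace_apply {A : Type*} [Ring A] [Algebra ℂ A] (x : A) :
    regularTrace A x = LinearMap.trace ℂ A (Algebra.lmul ℂ A x) := rfl

variable {A : Type*} [CStarAlgebra A] [FiniteDimensional ℂ A]

/-- A unital algebra homomorphism can only shrink the spectrum. Realness and positivity of spectra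
in `A` thereby pass to the eigenvalues whose sum is the trace. -/
theorem mem_spectrum_of_mem_roots_charpoly_lmul {A : Type*} [Ring A] [Algebra ℂ A]
    [FiniteDimensional ℂ A] {x : A} {z : ℂ}
    (hz : z ∈ (LinearMap.charpoly (Algebra.lmul ℂ A x)).roots) : z ∈ spectrum ℂ x := by
  have h := (Polynomial.mem_roots (LinearMap.charpoly_monic _).ne_zero).1 hz
  rw [← Module.End.hasEigenvalue_iff_isRoot_charpoly, Module.End.hasEigenvalue_iff_mem_spectrum]
    at h
  exact AlgHom.spectrum_apply_subset (Algebra.lmul ℂ A) x h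

theorem regularTrace_eq_sum_roots_charpoly {A : Type*} [Ring A] [Algebra ℂ A]
    [FiniteDimensional ℂ A] (x : A) :
    regularTrace A x = (LinearMap.charpoly (Algebra.lmul ℂ A x)).roots.sum :=
  Module.End.trace_eq_sum_roots_charpoly_of_splits (IsAlgClosed.splits _)

theorem regularTrace_mul_comm {A : Type*} [Ring A] [Algebra ℂ A] (x y : A) :
    regularTrace A (x * y) = regularTrace A (y * x) := by
  simp only [regularTrace_apply, map_mul, LinearMap.trace_mul_comm]

theorem IsSelfAdjoint.star_regularTrace {x : A} (hx : IsSelfAdjoint x) :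
    star (regularTrace A x) = regularTrace A x := by
  rw [regularTrace_eq_sum_roots_charpoly, ← starAddEquiv_apply, map_multiset_sum]
  congr 1
  refine (Multiset.map_congr rfl fun z hz => ?_).trans (Multiset.map_id _)
  rw [id, starAddEquiv_apply, hx.mem_spectrum_eq_re (mem_spectrum_of_mem_roots_charpoly_lmul hz)]
  exact Complex.conj_ofReal _

/-- No inner product is available yet to treat multiplication by `star x` as an adjoint. Real and
imaginary parts reduce the claim to self-adjoint elements, whose eigenvalues are real. -/
theorem regularTrace_star (x : A) :
    regularTrace A (star x) = star (regularTrace A x) := by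
  have hx := realPart_add_I_smul_imaginaryPart x
  rw [← hx]
  simp only [star_add, star_smul, map_add, map_smul, (realPart x).2.star_eq,
    (imaginaryPart x).2.star_eq, (realPart x).2.star_regularTrace,
    (imaginaryPart x).2.star_regularTrace]

theorem nonneg_of_mem_spectrum_star_mul_self {A : Type*} [CStarAlgebra A] {x : A} {z : ℂ}
    (hz : z ∈ spectrum ℂ (star x * x)) : 0 ≤ z := by
  have h := (IsSelfAdjoint.star_mul_self x).mem_spectrum_eq_re hz
  rw [h] at hz ⊢
  exact_mod_cast spectrum_star_mul_self_nonneg (b := x) z.re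
    ((spectrum.algebraMap_mem_iff (R := ℝ) ℂ).1 hz)

theorem regularTrace_star_mul_self_nonneg (x : A) : 0 ≤ regularTrace A (star x * x) := by
  rw [regularTrace_eq_sum_roots_charpoly]
  exact Multiset.sum_nonneg fun z hz =>
    nonneg_of_mem_spectrum_star_mul_self (mem_spectrum_of_mem_roots_charpoly_lmul hz)

theorem IsSelfAdjoint.eq_zero_of_isNilpotent {A : Type*} [CStarAlgebra A] {x : A}
    (hx : IsSelfAdjoint x) (h : IsNilpotent x) : x = 0 := by
  obtain ⟨n, hn⟩ := h
  -- For self-adjoint `x` the C*-identity iterates to `‖x ^ 2 ^ n‖ = ‖x‖ ^ 2 ^ n`, and `n ≤ 2 ^ n`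
  -- makes the left side vanish.
  have h2 := hx.nnnorm_pow_two_pow n
  rw [pow_eq_zero_of_le n.lt_two_pow_self.le hn, nnnorm_zero] at h2
  exact nnnorm_eq_zero.1 (pow_eq_zero_iff (by positivity) |>.1 h2.symm)

/-- Nonnegative eigenvalues with sum zero all vanish, so the characteristic polynomial is a power of
`X`. By Cayley–Hamilton and injectivity of the regular representation, `star x * x` is nilpotent;
being self-adjoint, it is zero. -/
theorem eq_zero_of_regularTrace_star_mul_self {x : A} (hx : regularTrace A (star x * x) = 0) :
    x = 0 := by
  rw [regularTrace_eq_sum_roots_charpoly] at hx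
  have h0 : ∀ z ∈ (LinearMap.charpoly (Algebra.lmul ℂ A (star x * x))).roots, z = 0 :=
    Multiset.all_zero_of_le_zero_le_of_sum_eq_zero (fun {z} hz =>
      nonneg_of_mem_spectrum_star_mul_self (mem_spectrum_of_mem_roots_charpoly_lmul hz)) hx
  have hX : LinearMap.charpoly (Algebra.lmul ℂ A (star x * x)) =
      Polynomial.X ^ Module.finrank ℂ A := by
    have hs := (IsAlgClosed.splits
      (LinearMap.charpoly (Algebra.lmul ℂ A (star x * x)))).eq_prod_roots_of_monic
      (LinearMap.charpoly_monic _)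
    have hd := (IsAlgClosed.splits
      (LinearMap.charpoly (Algebra.lmul ℂ A (star x * x)))).natDegree_eq_card_roots
    rw [LinearMap.charpoly_natDegree] at hd
    rw [hs, Multiset.eq_replicate_of_mem h0, ← hd]
    simp
  have hc := LinearMap.aeval_self_charpoly (Algebra.lmul ℂ A (star x * x))
  rw [hX, map_pow, Polynomial.aeval_X, ← map_pow] at hc
  have hn : IsNilpotent (star x * x) := ⟨_, Algebra.lmul_injective (hc.trans (map_zero _).symm)⟩
  exact CStarRing.star_mul_self_eq_zero_iff x |>.1
    ((IsSelfAdjoint.star_mul_self x).eq_zero_of_isNilpotent hn)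

end RegularTrace

namespace DagFrob

/-! ### Duality morphisms and involutions in an orthonormal basis. -/

section Hilb

variable {A B : Type*} [NormedAddCommGroup A] [InnerProductSpace ℂ A] [FiniteDimensional ℂ A]
  [NormedAddCommGroup B] [InnerProductSpace ℂ B] [FiniteDimensional ℂ B]

theorem inner_dual_riesz (φ : StrongDual ℂ A) (a : A) :
    inner ℂ φ (riesz A a) = star (φ a) := by
  change inner ℂ ((riesz A).symm (riesz A a)) ((riesz A).symm φ) = _
  rw [LinearIsometryEquiv.symm_apply_apply, ← inner_riesz_symm φ a]
  exact (inner_conj_symm _ _).symm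

theorem cup_one {ι : Type*} [Fintype ι] (e : OrthonormalBasis ι ℂ A) :
    cup A 1 = ∑ i, riesz A (e i) ⊗ₜ[ℂ] e i := by
  rw [TensorProduct.ext_iff_inner_left]
  intro φ a
  rw [cup, LinearMap.adjoint_inner_right, inner_sum]
  simp only [TensorProduct.inner_tmul, inner_dual_riesz]
  rw [show capDual A (φ ⊗ₜ a) = φ a from rfl]
  conv_lhs => rw [← e.sum_repr' a]
  simp [mul_comm]

theorem cupDual_one {ι : Type*} [Fintype ι] (e : OrthonormalBasis ι ℂ A) :
    cupDual A 1 = ∑ i, e i ⊗ₜ[ℂ] riesz A (e i) := by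
  rw [TensorProduct.ext_iff_inner_left]
  intro a φ
  rw [cupDual, LinearMap.adjoint_inner_right, inner_sum]
  simp only [TensorProduct.inner_tmul, inner_dual_riesz]
  rw [show cap A (a ⊗ₜ φ) = φ a from rfl]
  conv_lhs => rw [← e.sum_repr' a]
  simp [mul_comm]

theorem isUnitaryMap_iff (f : A →ₗ[ℂ] B) :
    IsUnitaryMap f ↔ (∀ a b, inner ℂ (f a) (f b) = inner ℂ a b) ∧ Function.Surjective f := by
  constructor
  · rintro ⟨h₁, h₂⟩
    refine ⟨fun a b => ?_, fun b => ⟨LinearMap.adjoint f b, LinearMap.congr_fun h₂ b⟩⟩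
    rw [← LinearMap.adjoint_inner_right]
    exact congrArg _ (LinearMap.congr_fun h₁ b)
  · rintro ⟨h, hs⟩
    have h₁ : ∀ b, LinearMap.adjoint f (f b) = b := fun b =>
      ext_inner_left ℂ fun a => by rw [LinearMap.adjoint_inner_right, h]
    refine ⟨LinearMap.ext h₁, LinearMap.ext fun b => ?_⟩
    obtain ⟨a, rfl⟩ := hs b
    exact congrArg f (h₁ a)

end Hilb

namespace HilbMonoid

variable (M : HilbMonoid.{u})

theorem counit_apply (a : M.obj) : M.counit a = inner ℂ (M.unit 1) a := by
  have h := LinearMap.adjoint_inner_right M.unit 1 a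
  simpa [counit] using h

/-- The cup contributes `∑ e i ⊗ ⟪e i, ·⟫`; evaluating at `b` resums the basis expansion of `b`. -/
theorem leftInvolution_apply (a b : M.obj) :
    M.leftInvolution a b = inner ℂ (M.unit 1) (M.mul (a ⊗ₜ b)) := by
  let e := stdOrthonormalBasis ℂ M.obj
  have h : M.leftInvolution a =
      ∑ i, inner ℂ (M.unit 1) (M.mul (a ⊗ₜ e i)) • riesz M.obj (e i) := by
    simp [leftInvolution, cupDual_one e, TensorProduct.tmul_sum, counit_apply]
  rw [h]
  conv_rhs => rw [← e.sum_repr' b]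
  simp [TensorProduct.tmul_sum, riesz_apply, mul_comm]

theorem rightInvolution_apply (a b : M.obj) :
    M.rightInvolution a b = inner ℂ (M.unit 1) (M.mul (b ⊗ₜ a)) := by
  let e := stdOrthonormalBasis ℂ M.obj
  have h : M.rightInvolution a =
      ∑ i, inner ℂ (M.unit 1) (M.mul (e i ⊗ₜ a)) • riesz M.obj (e i) := by
    simp [rightInvolution, cup_one e, TensorProduct.sum_tmul, counit_apply]
  rw [h]
  conv_rhs => rw [← e.sum_repr' b]
  simp [TensorProduct.sum_tmul, riesz_apply, mul_comm,
    ← TensorProduct.smul_tmul']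

end HilbMonoid

/-! ### Adjoints of multiplications, the Frobenius law, unitarity and specialness. -/

namespace InvolutionMonoid

variable {M : InvolutionMonoid.{u}}

theorem inner_antiInvol (a b : M.obj) : inner ℂ (M.antiInvol a) b = M.invol a b :=
  inner_riesz_symm _ _

theorem invol_eq_rightInvolution_iff : M.invol = M.rightInvolution ↔
    ∀ a b, inner ℂ (M.antiInvol a) b = inner ℂ (M.unit 1) (M.mul (b ⊗ₜ a)) := by
  simp only [LinearMap.ext_iff, ContinuousLinearMap.ext_iff, inner_antiInvol,
    HilbMonoid.rightInvolution_apply]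

/-- The adjoint of right multiplication by `c` is right multiplication by `c^*`. -/
theorem inner_mul_eq_inner_mul_antiInvol (hR : M.invol = M.rightInvolution) (a c b : M.obj) :
    inner ℂ (M.mul (a ⊗ₜ c)) b = inner ℂ a (M.mul (b ⊗ₜ M.antiInvol c)) := by
  rw [invol_eq_rightInvolution_iff] at hR
  -- `⟪ac, b⟫ = ⟪1, b(c^* a^*)⟫ = ⟪1, (b c^*) a^*⟫ = ⟪a, b c^*⟫`.
  rw [← M.antiInvol_antiInvol (M.mul (a ⊗ₜ c)), hR, antiInvol_mul, ← mul_assoc', ← hR,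
    antiInvol_antiInvol]

/-- Let `J'` be the antilinear form of `s_L`. Then `⟪J' a, b⟫ = ⟪1, ab⟫ = ⟪b^*, a⟫`. Putting `J' b`
for `b`, unitarity turns the left side into `⟪b, a⟫`, so `(J' b)^* = b`. -/
theorem leftInvolution_eq (hR : M.invol = M.rightInvolution) (hU : M.IsUnitary) :
    M.leftInvolution = M.invol := by
  have hU := ((isUnitaryMap_iff _).1 hU).1
  set J' : M.obj → M.obj := fun a => (riesz M.obj).symm (M.leftInvolution a) with hJ'
  have h : ∀ a b, inner ℂ (J' a) b = inner ℂ (M.antiInvol b) a := fun a b => by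
    rw [hJ', inner_riesz_symm, HilbMonoid.leftInvolution_apply,
      invol_eq_rightInvolution_iff.1 hR]
  have h2 : ∀ b, M.antiInvol (J' b) = b := fun b => ext_inner_right ℂ fun a => by
    rw [← h, ← hU b a]
    -- The inner product of the dual swaps its arguments, which matches the order here.
    exact rfl
  refine LinearMap.ext fun a => ?_
  rw [← (riesz M.obj).apply_symm_apply (M.leftInvolution a), ← riesz_antiInvol]
  congr 1
  conv_rhs => rw [← h2 a, antiInvol_antiInvol]

theorem inner_unit_mul (hR : M.invol = M.rightInvolution) (hU : M.IsUnitary) (a b : M.obj) :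
    inner ℂ (M.unit 1) (M.mul (a ⊗ₜ b)) = inner ℂ (M.antiInvol a) b := by
  rw [inner_antiInvol, ← leftInvolution_eq hR hU, HilbMonoid.leftInvolution_apply]

/-- If `⟪1, ab⟫ = ⟪a^*, b⟫` then the adjoint of left multiplication by `a` is left multiplication
by `a^*`. -/
theorem inner_mul_eq_inner_antiInvol_mul
    (hL : ∀ a b, inner ℂ (M.unit 1) (M.mul (a ⊗ₜ b)) = inner ℂ (M.antiInvol a) b)
    (a c b : M.obj) :
    inner ℂ (M.mul (a ⊗ₜ c)) b = inner ℂ c (M.mul (M.antiInvol a ⊗ₜ b)) := by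
  rw [← M.antiInvol_antiInvol (M.mul (a ⊗ₜ c)), ← hL, antiInvol_mul, mul_assoc', hL,
    antiInvol_antiInvol]

/-- Pairing with `a ⊗ b` gives `⟪ab, x⟫`; expand `a` in the basis and move each `e i` across the
inner product. -/
theorem comul_eq_sum_left {ι : Type*} [Fintype ι] (e : OrthonormalBasis ι ℂ M.obj)
    (hL : ∀ a b, inner ℂ (M.unit 1) (M.mul (a ⊗ₜ b)) = inner ℂ (M.antiInvol a) b) (x : M.obj) :
    M.comul x = ∑ i, e i ⊗ₜ[ℂ] M.mul (M.antiInvol (e i) ⊗ₜ x) := by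
  rw [TensorProduct.ext_iff_inner_left]
  intro a b
  rw [HilbMonoid.comul, LinearMap.adjoint_inner_right, inner_sum]
  simp only [TensorProduct.inner_tmul, ← inner_mul_eq_inner_antiInvol_mul hL]
  conv_lhs => rw [← e.sum_repr' a]
  simp [TensorProduct.sum_tmul, sum_inner, ← TensorProduct.smul_tmul', inner_smul_left]

theorem comul_eq_sum_right {ι : Type*} [Fintype ι] (e : OrthonormalBasis ι ℂ M.obj)
    (hR : M.invol = M.rightInvolution) (x : M.obj) :
    M.comul x = ∑ i, M.mul (x ⊗ₜ M.antiInvol (e i)) ⊗ₜ[ℂ] e i := by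
  rw [TensorProduct.ext_iff_inner_left]
  intro a b
  rw [HilbMonoid.comul, LinearMap.adjoint_inner_right, inner_sum]
  simp only [TensorProduct.inner_tmul, ← inner_mul_eq_inner_mul_antiInvol hR]
  conv_lhs => rw [← e.sum_repr' b]
  simp [TensorProduct.tmul_sum, sum_inner, inner_smul_left, mul_comm]

/-- Together `hR` and `hL` say that `⟪1, ·⟫` is a trace. Each half of the Frobenius law is
associativity applied to one of the two basis formulas for `m^†`. -/
theorem isFrobenius_of_trace (hR : M.invol = M.rightInvolution)
    (hL : ∀ a b, inner ℂ (M.unit 1) (M.mul (a ⊗ₜ b)) = inner ℂ (M.antiInvol a) b) :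
    M.IsFrobenius := by
  let e := stdOrthonormalBasis ℂ M.obj
  constructor
  · refine TensorProduct.ext' fun a b => ?_
    simp [comul_eq_sum_right e hR, TensorProduct.tmul_sum, mul_assoc']
  · refine TensorProduct.ext' fun a b => ?_
    simp [comul_eq_sum_left e hL, TensorProduct.sum_tmul, mul_assoc']

theorem isUnitary_of_trace (hR : M.invol = M.rightInvolution)
    (hL : ∀ a b, inner ℂ (M.unit 1) (M.mul (a ⊗ₜ b)) = inner ℂ (M.antiInvol a) b) :
    M.IsUnitary := by
  have h : ∀ a, M.leftInvolution a = riesz M.obj (M.antiInvol a) := fun a =>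
    ContinuousLinearMap.ext fun b => by
      rw [HilbMonoid.leftInvolution_apply, hL, riesz_apply]
  refine (isUnitaryMap_iff _).2 ⟨fun a b => ?_, fun φ => ?_⟩
  · rw [h, h, inner_dual_riesz, riesz_apply]
    refine (inner_conj_symm _ _).trans ?_
    -- `⟪b^*, a^*⟫ = ⟪1, a^* b⟫ = ⟪a, b⟫`.
    rw [invol_eq_rightInvolution_iff.1 hR, hL, antiInvol_antiInvol]
  · exact ⟨M.antiInvol ((riesz M.obj).symm φ), by
      rw [h, antiInvol_antiInvol, LinearIsometryEquiv.apply_symm_apply]⟩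

/-- Left multiplication by an element. -/
noncomputable def leftMul (a : M.obj) : M.obj →ₗ[ℂ] M.obj := M.mul ∘ₗ TensorProduct.mk ℂ _ _ a

/-- Let `z = m (m^† 1) = ∑ e i (e i)^*`. Then `m (m^† x) = z x`, while left multiplication by `y`
has trace `⟪y^*, z⟫` and `⟪1, y⟫ = ⟪y^*, 1⟫`. Both conditions therefore say `z = 1`. -/
theorem inner_unit_eq_trace_iff_isSpecial (hR : M.invol = M.rightInvolution)
    (hL : ∀ a b, inner ℂ (M.unit 1) (M.mul (a ⊗ₜ b)) = inner ℂ (M.antiInvol a) b) :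
    (∀ y, inner ℂ (M.unit 1) y = LinearMap.trace ℂ M.obj (leftMul y)) ↔ M.IsSpecial := by
  let e := stdOrthonormalBasis ℂ M.obj
  have hR' := invol_eq_rightInvolution_iff.1 hR
  have hsum : ∀ y, LinearMap.trace ℂ M.obj (leftMul y) =
      inner ℂ (M.antiInvol y) (M.mul (M.comul (M.unit 1))) := fun y => by
    rw [LinearMap.trace_eq_sum_inner _ e, comul_eq_sum_left e hL, map_sum, inner_sum]
    refine Finset.sum_congr rfl fun i _ => ?_
    rw [mul_one', ← hL, ← mul_assoc', ← hR', antiInvol_antiInvol]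
    rfl
  have hone : ∀ x, M.mul (M.comul x) = M.mul (M.mul (M.comul (M.unit 1)) ⊗ₜ x) := fun x => by
    simp only [comul_eq_sum_left e hL, map_sum, TensorProduct.sum_tmul, mul_one', mul_assoc']
  constructor
  · intro h
    have h1 : M.mul (M.comul (M.unit 1)) = M.unit 1 := ext_inner_left ℂ fun v => by
      rw [← M.antiInvol_antiInvol v, ← hsum, ← h, ← hL, mul_one']
    exact LinearMap.ext fun x => by
      rw [LinearMap.comp_apply, hone, h1, one_mul', LinearMap.id_apply]
  · intro h y
    rw [hsum, show M.mul (M.comul (M.unit 1)) = M.unit 1 from LinearMap.congr_fun h _, ← hL,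
      mul_one']

end InvolutionMonoid

/-! ### Uniqueness of the C*-norm and the trace inner product. -/

namespace FdStarAlg

variable {X : FdStarAlg.{u}}

/-- The C*-algebra given by an algebra norm with the C*-identity. -/
@[reducible]
noncomputable def toCStarAlgebra (N : AlgebraNorm ℂ X) (hN : ∀ a : X, N (star a * a) = N a ^ 2) :
    CStarAlgebra X :=
  letI : NormedRing X := N.toRingNorm.toNormedRing
  letI : NormedAlgebra ℂ X := { (inferInstance : Algebra ℂ X) with
    norm_smul_le := fun z a => (map_smul_eq_mul N z a).le }
  { (inferInstance : NormedRing X), (inferInstance : StarRing X),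
    (inferInstance : NormedAlgebra ℂ X), (inferInstance : StarModule ℂ X) with
    complete := (FiniteDimensional.complete ℂ X).complete
    norm_mul_self_le := fun a => (pow_two (N a)).symm.le.trans (hN a).ge }

theorem isCStarNorm_iff (N : AlgebraNorm ℂ X) :
    IsCStarNorm N ↔ ∀ a : X, N (star a * a) = N a ^ 2 := by
  refine ⟨fun h => h.1, fun h => ⟨h, fun x hx => ?_⟩⟩
  let := toCStarAlgebra N h
  have hd : ∀ a b : X, dist a b = N (a - b) := fun a b => dist_eq_norm a b
  have hc : CauchySeq x := Metric.cauchySeq_iff.2 fun δ hδ => by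
    simpa only [hd] using hx δ hδ
  obtain ⟨l, hl⟩ := cauchySeq_tendsto_of_complete hc
  refine ⟨l, fun δ hδ => ?_⟩
  simpa only [hd] using Metric.tendsto_atTop.1 hl δ hδ

/-- The right-hand side depends only on the `*`-algebra, which forces uniqueness of the norm. -/
theorem IsCStarNorm.eq_sqrt_spectralRadius {N : AlgebraNorm ℂ X} (hN : IsCStarNorm N) (a : X) :
    N a = √ (spectralRadius ℂ (star a * a)).toReal := by
  let := toCStarAlgebra N hN.1
  rw [(IsSelfAdjoint.star_mul_self a).spectralRadius_eq_nnnorm, ENNReal.coe_toReal, coe_nnnorm]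
  exact (Real.sqrt_eq_iff_mul_self_eq (apply_nonneg N _) (apply_nonneg N _)).2
    ((hN.1 a).trans (pow_two _)) |>.symm

theorem existsUnique_isCStarNorm (hX : admitsCStarNorm X) :
    ∃! N : AlgebraNorm ℂ X, IsCStarNorm N := by
  obtain ⟨N, hN⟩ := hX
  refine ⟨N, hN, fun N' hN' => AlgebraNorm.ext fun a => ?_⟩
  rw [IsCStarNorm.eq_sqrt_spectralRadius hN', IsCStarNorm.eq_sqrt_spectralRadius hN]

/-- The inner product `⟪a, b⟫ = Tr (a^* b)` given by the regular trace of a C*-algebra. -/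
@[reducible]
noncomputable def traceCore (N : AlgebraNorm ℂ X) (hN : IsCStarNorm N) :
    InnerProductSpace.Core ℂ X :=
  letI := toCStarAlgebra N hN.1
  { inner := fun a b => regularTrace X (star a * b)
    conj_inner_symm := fun a b => by
      change star (regularTrace X (star b * a)) = regularTrace X (star a * b)
      rw [← regularTrace_star, star_mul, star_star]
    re_inner_nonneg := fun a => (Complex.nonneg_iff.1 (regularTrace_star_mul_self_nonneg a)).1
    add_left := fun a b d => by
      change regularTrace X (star (a + b) * d) = regularTrace X _ + regularTrace X _
      rw [star_add, add_mul, map_add]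
    smul_left := fun a b z => by
      change regularTrace X (star (z • a) * b) = star z • regularTrace X _
      rw [star_smul, smul_mul_assoc, map_smul]
    definite := fun a => eq_zero_of_regularTrace_star_mul_self }

theorem antiInvol_toInvolutionMonoid (c : InnerProductSpace.Core ℂ X) (a : X) :
    (X.toInvolutionMonoid c).antiInvol (X.toHilb c a) = X.toHilb c (star a) :=
  (riesz (X.hilb c)).symm_apply_apply _

theorem mul_toInvolutionMonoid (c : InnerProductSpace.Core ℂ X) (a b : X) :
    (X.toInvolutionMonoid c).mul (X.toHilb c a ⊗ₜ X.toHilb c b) = X.toHilb c (a * b) := rfl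

theorem unit_toInvolutionMonoid (c : InnerProductSpace.Core ℂ X) :
    (X.toInvolutionMonoid c).unit 1 = X.toHilb c 1 :=
  congrArg (X.toHilb c) (map_one (algebraMap ℂ X))

/-- Here `⟪1, ab⟫` is the regular trace of `ab`. This gives `hL` directly, `hR` by traciality, and
specialness because `⟪1, ·⟫` is the regular trace itself. -/
theorem specialUnitaryFrobenius_traceCore (N : AlgebraNorm ℂ X) (hN : IsCStarNorm N) :
    InvolutionMonoid.specialUnitaryFrobenius (X.toInvolutionMonoid (traceCore N hN)) := by
  set c := traceCore N hN
  set M := X.toInvolutionMonoid c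
  have hin : ∀ a b : X, inner ℂ (E := M.obj) (X.toHilb c a) (X.toHilb c b) =
      regularTrace X (star a * b) := fun a b => rfl
  have hL : ∀ a b, inner ℂ (M.unit 1) (M.mul (a ⊗ₜ b)) = inner ℂ (M.antiInvol a) b := by
    intro a b
    obtain ⟨a, rfl⟩ := (X.toHilb c).surjective a
    obtain ⟨b, rfl⟩ := (X.toHilb c).surjective b
    rw [antiInvol_toInvolutionMonoid, mul_toInvolutionMonoid, unit_toInvolutionMonoid, hin, hin,
      star_one, one_mul, star_star]
  have hR : M.invol = M.rightInvolution := by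
    rw [InvolutionMonoid.invol_eq_rightInvolution_iff]
    intro a b
    obtain ⟨a, rfl⟩ := (X.toHilb c).surjective a
    obtain ⟨b, rfl⟩ := (X.toHilb c).surjective b
    rw [antiInvol_toInvolutionMonoid, mul_toInvolutionMonoid, unit_toInvolutionMonoid, hin, hin,
      star_one, one_mul, star_star, regularTrace_mul_comm]
  refine ⟨⟨⟨InvolutionMonoid.isFrobenius_of_trace hR hL, hR⟩,
    InvolutionMonoid.isUnitary_of_trace hR hL⟩,
    (InvolutionMonoid.inner_unit_eq_trace_iff_isSpecial hR hL).1 fun y => ?_⟩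
  obtain ⟨y, rfl⟩ := (X.toHilb c).surjective y
  rw [unit_toInvolutionMonoid, hin, star_one, one_mul]
  rfl

end FdStarAlg

/-! ### The C*-norm from right multiplication. -/

namespace InvolutionMonoid

variable {M : InvolutionMonoid.{u}}

/-- Right multiplication by an element, as a bounded operator. -/
noncomputable def rightMul (M : InvolutionMonoid.{u}) : M.obj →ₗ[ℂ] M.obj →L[ℂ] M.obj :=
  LinearMap.toContinuousLinearMap.toLinearMap ∘ₗ (TensorProduct.curry M.mul).flip

theorem rightMul_apply (a b : M.obj) : M.rightMul a b = M.mul (b ⊗ₜ a) := rfl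

theorem adjoint_rightMul (hR : M.invol = M.rightInvolution) (a : M.obj) :
    haveI := FiniteDimensional.complete ℂ M.obj
    ContinuousLinearMap.adjoint (M.rightMul a) = M.rightMul (M.antiInvol a) := by
  have := FiniteDimensional.complete ℂ M.obj
  refine ContinuousLinearMap.ext fun b => ext_inner_left ℂ fun v => ?_
  rw [ContinuousLinearMap.adjoint_inner_right, rightMul_apply, rightMul_apply,
    inner_mul_eq_inner_mul_antiInvol hR]

theorem rightMul_mul (a b : M.obj) :
    M.rightMul (M.mul (a ⊗ₜ b)) = (M.rightMul b).comp (M.rightMul a) :=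
  ContinuousLinearMap.ext fun x => (M.mul_assoc' x a b).symm

/-- The operator norm of right multiplication. -/
noncomputable def rightMulNorm (M : InvolutionMonoid.{u}) : AlgebraNorm ℂ M.toStarAlg where
  toFun := fun a : M.obj => ‖M.rightMul a‖
  map_zero' := (congrArg norm (map_zero M.rightMul)).trans norm_zero
  add_le' := fun a b => (congrArg norm (map_add M.rightMul a b)).trans_le (norm_add_le _ _)
  neg' := fun a => (congrArg norm (map_neg M.rightMul a)).trans (norm_neg _)
  mul_le' := fun a b => (congrArg norm (rightMul_mul a b)).trans_le
    ((ContinuousLinearMap.opNorm_comp_le _ _).trans_eq (mul_comm _ _))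
  smul' := fun z a => (congrArg norm (map_smul M.rightMul z a)).trans (norm_smul _ _)
  eq_zero_of_map_eq_zero' := fun a h => by
    -- Right multiplication by `a` sends the unit to `a`, so the representation is faithful.
    have h0 := DFunLike.congr_fun (norm_eq_zero.1 h) (M.unit 1)
    exact (M.one_mul' a).symm.trans h0

/-- Right multiplication reverses products, so `a^* a` acts as `R R^†` with `R` right multiplication
by `a`; the C*-identity for operators applies. -/
theorem isCStarNorm_rightMulNorm (hR : M.invol = M.rightInvolution) :
    FdStarAlg.IsCStarNorm M.rightMulNorm := by
  have := FiniteDimensional.complete ℂ M.obj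
  refine (FdStarAlg.isCStarNorm_iff _).2 fun (a : M.obj) => ?_
  change ‖M.rightMul (M.mul (M.antiInvol a ⊗ₜ a))‖ = ‖M.rightMul a‖ ^ 2
  rw [rightMul_mul, ← adjoint_rightMul hR, pow_two]
  exact CStarRing.norm_self_mul_star (x := M.rightMul a)

theorem admitsCStarNorm_toStarAlg (hR : M.invol = M.rightInvolution) :
    FdStarAlg.admitsCStarNorm M.toStarAlg :=
  ⟨M.rightMulNorm, isCStarNorm_rightMulNorm hR⟩

end InvolutionMonoid

/-! ### Equality of objects under the two passages. -/

namespace FdStarAlg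

variable {X : FdStarAlg.{u}}

/-- Bijectivity on objects needs literal equality of bundled algebras. On a fixed carrier the
operations determine everything, the structure map of the algebra being `z ↦ z • 1`. -/
theorem mk_eq_mk {α : Type u} (r r' : Ring α) (al : @Algebra ℂ α _ r.toSemiring)
    (al' : @Algebra ℂ α _ r'.toSemiring)
    (s : @StarRing α r.toNonUnitalNonAssocSemiring)
    (s' : @StarRing α r'.toNonUnitalNonAssocSemiring)
    (sm : @StarModule ℂ α _ s.toStar al.toSMul) (sm' : @StarModule ℂ α _ s'.toStar al'.toSMul)
    (fd : @FiniteDimensional ℂ α _ r.toAddCommGroup al.toModule)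
    (fd' : @FiniteDimensional ℂ α _ r'.toAddCommGroup al'.toModule)
    (hadd : ∀ a b, r.add a b = r'.add a b) (hmul : ∀ a b, r.mul a b = r'.mul a b)
    (hsmul : ∀ (z : ℂ) a, al.smul z a = al'.smul z a) (hstar : ∀ a, s.star a = s'.star a) :
    @FdStarAlg.mk α r al s sm fd = @FdStarAlg.mk α r' al' s' sm' fd' := by
  obtain rfl : r = r' := Ring.ext (funext₂ hadd) (funext₂ hmul)
  obtain rfl : al = al' := by
    refine Algebra.algebra_ext _ _ fun z => ?_
    exact (@Algebra.algebraMap_eq_smul_one ℂ α _ _ al z).trans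
      ((hsmul z 1).trans (@Algebra.algebraMap_eq_smul_one ℂ α _ _ al' z).symm)
  obtain rfl : s = s' := by
    obtain @⟨@⟨@⟨⟨_⟩, _⟩, _⟩, _⟩ := s
    obtain @⟨@⟨@⟨⟨_⟩, _⟩, _⟩, _⟩ := s'
    obtain rfl := funext hstar
    rfl
  rfl

theorem toStarAlg_toInvolutionMonoid (c : InnerProductSpace.Core ℂ X) :
    (X.toInvolutionMonoid c).toStarAlg = X :=
  mk_eq_mk _ _ _ _ _ _ _ _ _ _ (fun _ _ => rfl) (mul_toInvolutionMonoid c) (fun _ _ => rfl)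
    (antiInvol_toInvolutionMonoid c)

/-- The inner product is determined by specialness and unitarity. -/
theorem inner_eq_regularTrace {c : InnerProductSpace.Core ℂ X}
    (h : InvolutionMonoid.specialUnitaryFrobenius (X.toInvolutionMonoid c)) (a b : X) :
    c.inner a b = regularTrace X (star a * b) := by
  obtain ⟨⟨⟨-, hR⟩, hU⟩, hS⟩ := h
  have hL := InvolutionMonoid.inner_unit_mul hR hU
  have h1 := (InvolutionMonoid.inner_unit_eq_trace_iff_isSpecial hR hL).2 hS
    (X.toHilb c (star a * b))
  have h2 := hL (X.toHilb c (star a)) (X.toHilb c b)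
  rw [antiInvol_toInvolutionMonoid, star_star] at h2
  exact h2.symm.trans h1

theorem core_ext {V : Type*} [AddCommGroup V] [Module ℂ V] {c c' : InnerProductSpace.Core ℂ V}
    (h : ∀ a b, c.inner a b = c'.inner a b) : c = c' := by
  obtain ⟨⟨⟨_⟩, _⟩, _⟩ := c
  obtain ⟨⟨⟨_⟩, _⟩, _⟩ := c'
  obtain rfl := funext₂ h
  rfl

end FdStarAlg

namespace InvolutionMonoid

theorem eq_of_obj_eq {H : FdHilb.{u}} {mul mul' : H ⊗[ℂ] H →ₗ[ℂ] H} {unit unit' : ℂ →ₗ[ℂ] H}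
    {s s' : H →ₗ[ℂ] StrongDual ℂ H} (ha hl hr hm hu hi ha' hl' hr' hm' hu' hi')
    (hmul : mul = mul') (hunit : unit = unit') (hs : s = s') :
    (⟨⟨H, mul, unit, ha, hl, hr⟩, s, hm, hu, hi⟩ : InvolutionMonoid.{u}) =
      ⟨⟨H, mul', unit', ha', hl', hr'⟩, s', hm', hu', hi'⟩ := by
  subst hmul hunit hs
  rfl

theorem toInvolutionMonoid_toStarAlg (M : InvolutionMonoid.{u}) :
    M.toStarAlg.toInvolutionMonoid M.obj.core = M :=
  eq_of_obj_eq _ _ _ _ _ _ _ _ _ _ _ _ (TensorProduct.ext' fun _ _ => rfl)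
    (LinearMap.ext_ring (one_smul ℂ (M.unit 1))) (LinearMap.ext M.riesz_antiInvol)

theorem toStarAlg_injective {M N : InvolutionMonoid.{u}} (hM : specialUnitaryFrobenius M)
    (hN : specialUnitaryFrobenius N) (h : M.toStarAlg = N.toStarAlg) : M = N := by
  -- The inner products live over different algebras, so the algebras are made variables that can be
  -- identified before comparing.
  have key : ∀ (X Y : FdStarAlg.{u}) (c : InnerProductSpace.Core ℂ X)
      (c' : InnerProductSpace.Core ℂ Y), X = Y →
      specialUnitaryFrobenius (X.toInvolutionMonoid c) →
      specialUnitaryFrobenius (Y.toInvolutionMonoid c') →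
      X.toInvolutionMonoid c = Y.toInvolutionMonoid c' := by
    rintro X _ c c' rfl hc hc'
    rw [FdStarAlg.core_ext fun a b => (FdStarAlg.inner_eq_regularTrace hc a b).trans
      (FdStarAlg.inner_eq_regularTrace hc' a b).symm]
  rw [← toInvolutionMonoid_toStarAlg M, ← toInvolutionMonoid_toStarAlg N]
  refine key _ _ _ _ h ?_ ?_ <;> rwa [toInvolutionMonoid_toStarAlg]

/-! ### The underlying-algebra functor. -/

instance underlying_faithful : underlying.{u}.Faithful where
  map_injective {M N _ _} h := Hom.ext (LinearMap.ext fun a =>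
    DFunLike.congr_fun (F := M.toStarAlg →⋆ₐ[ℂ] N.toStarAlg) h a)

/-- Since `f_* ⟪a, ·⟫ = ⟪f a, ·⟫`, the condition `s_B ∘ f = f_* ∘ s_A` is just `f (a^*) = (f a)^*`,
with no compatibility with the inner products. -/
instance underlying_full : underlying.{u}.Full where
  map_surjective {M N} (f : M.toStarAlg →⋆ₐ[ℂ] N.toStarAlg) := by
    let g : M.obj →ₗ[ℂ] N.obj :=
      { toFun := f
        map_add' := map_add f
        map_smul' := map_smul f }
    refine ⟨⟨g, TensorProduct.ext' (map_mul (M := M.toStarAlg) f), LinearMap.ext_ring (map_one f), ?_⟩,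
      rfl⟩
    refine LinearMap.ext fun a => ?_
    rw [LinearMap.comp_apply, LinearMap.comp_apply, ← riesz_antiInvol, ← riesz_antiInvol,
      conjMap_riesz]
    exact congrArg _ (map_star (R := M.toStarAlg) f a).symm

/-- The underlying C*-algebra of an involution monoid with `s = s_R`. -/
noncomputable def underlyingCStar (P : ObjectProperty InvolutionMonoid.{u})
    (hP : P ≤ rightFrobenius) : P.FullSubcategory ⥤ FdCStarAlg.{u} :=
  FdStarAlg.admitsCStarNorm.lift (P.ι ⋙ underlying)
    fun M => admitsCStarNorm_toStarAlg (hP _ M.property).2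

variable (P : ObjectProperty InvolutionMonoid.{u}) (hP : P ≤ rightFrobenius)

instance underlyingCStar_faithful : (underlyingCStar P hP).Faithful :=
  Functor.Faithful.of_comp_iso (FdStarAlg.admitsCStarNorm.liftCompιIso (P.ι ⋙ underlying) _)

instance underlyingCStar_full : (underlyingCStar P hP).Full :=
  Functor.Full.of_comp_faithful_iso
    (FdStarAlg.admitsCStarNorm.liftCompιIso (P.ι ⋙ underlying) _)

/-- The trace inner product gives a special preimage, which lies in every class `P` considered. -/
theorem underlyingCStar_obj_surjective (hS : specialUnitaryFrobenius ≤ P) :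
    Function.Surjective (underlyingCStar P hP).obj := by
  rintro ⟨X, N, hN⟩
  refine ⟨⟨_, hS _ (FdStarAlg.specialUnitaryFrobenius_traceCore N hN)⟩, ?_⟩
  exact ObjectProperty.FullSubcategory.ext (FdStarAlg.toStarAlg_toInvolutionMonoid _)

theorem underlyingCStar_isEquivalence (hS : specialUnitaryFrobenius ≤ P) :
    (underlyingCStar P hP).IsEquivalence where
  essSurj := ⟨fun X => by
    obtain ⟨M, rfl⟩ := underlyingCStar_obj_surjective P hP hS X
    exact (underlyingCStar P hP).obj_mem_essImage M⟩

end InvolutionMonoid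

theorem FdStarAlg.admitsCStarNorm_eq :
    FdStarAlg.admitsCStarNorm.{u} = FdStarAlg.admitsSpecialUnitaryFrobenius := by
  refine funext fun X => propext ⟨fun ⟨N, hN⟩ => ⟨_, specialUnitaryFrobenius_traceCore N hN⟩, ?_⟩
  rintro ⟨c, hc⟩
  rw [← toStarAlg_toInvolutionMonoid c]
  exact InvolutionMonoid.admitsCStarNorm_toStarAlg hc.1.1.2

end DagFrob

theorem mainTheorem2 :
    -- the category of finite-dimensional C*-algebras equals that of special unitary †-Frobenius
    -- involution monoids: the two full subcategories of `*`-algebras have the same objects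
    (FdStarAlg.admitsCStarNorm.{u} = FdStarAlg.admitsSpecialUnitaryFrobenius.{u} ∧
      Cat.of FdCStarAlg.{u} = Cat.of SpecialUnitaryFrobAlg.{u}) ∧
    -- with C*-norms and inner products as part of the objects: the norm is unique, and the
    -- underlying `*`-algebra defines an isomorphism of categories
    ((∀ X : FdStarAlg.{u}, FdStarAlg.admitsCStarNorm X →
        ∃! N : AlgebraNorm ℂ X, FdStarAlg.IsCStarNorm N) ∧
      ∃ F : SpecialUnitaryFrobMon.{u} ⥤ FdCStarAlg.{u},
        F ⋙ FdStarAlg.admitsCStarNorm.ι =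
          InvolutionMonoid.specialUnitaryFrobenius.ι ⋙ InvolutionMonoid.underlying ∧
        F.Full ∧ F.Faithful ∧ Function.Bijective F.obj) ∧
    -- unitary †-Frobenius involution monoids: the underlying `*`-algebra defines an equivalence
    (∃ F : UnitaryFrobMon.{u} ⥤ FdCStarAlg.{u},
        F ⋙ FdStarAlg.admitsCStarNorm.ι =
          InvolutionMonoid.unitaryFrobenius.ι ⋙ InvolutionMonoid.underlying ∧
        F.IsEquivalence) ∧
    -- †-Frobenius right-involution monoids: the underlying `*`-algebra defines an equivalence
    (∃ F : RightFrobMon.{u} ⥤ FdCStarAlg.{u},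
        F ⋙ FdStarAlg.admitsCStarNorm.ι =
          InvolutionMonoid.rightFrobenius.ι ⋙ InvolutionMonoid.underlying ∧
        F.IsEquivalence) := by
  refine ⟨⟨FdStarAlg.admitsCStarNorm_eq,
      congrArg (fun P : ObjectProperty FdStarAlg.{u} => Cat.of P.FullSubcategory)
        FdStarAlg.admitsCStarNorm_eq⟩,
    ⟨fun X => FdStarAlg.existsUnique_isCStarNorm,
      InvolutionMonoid.underlyingCStar _ fun M h => h.1.1, rfl, inferInstance, inferInstance,
      fun M N h => ?_, InvolutionMonoid.underlyingCStar_obj_surjective _ _ le_rfl⟩,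
    ⟨InvolutionMonoid.underlyingCStar _ fun M h => h.1, rfl,
      InvolutionMonoid.underlyingCStar_isEquivalence _ _ fun M h => h.1⟩,
    ⟨InvolutionMonoid.underlyingCStar _ le_rfl, rfl,
      InvolutionMonoid.underlyingCStar_isEquivalence _ _ fun M h => h.1.1⟩⟩
  exact ObjectProperty.FullSubcategory.ext (InvolutionMonoid.toStarAlg_injective M.property
    N.property (congrArg ObjectProperty.FullSubcategory.obj h))
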